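/- Let $(X,d)$ be a Polish (complete separable) metric space, and let $\mathcal M(X)$ be the set of nonnegative finite Borel measures on $X$. Write $|\mu|=\mu(X)$ for the mass of $\mu\in\mathcal M(X)$, and write $|\mu-\nu|$ for the total variation of the signed measure $\mu-\nu$. Let $\mathcal M_1(X)$ be the set of $\mu\in\mathcal M(X)$ with $\int_X d(x,x_0)\,d\mu(x)<\infty$ for every $x_0\in X$. For $\mu,\nu\in\mathcal M_1(X)$ with $|\mu|=|\nu|$ let $$W_1(\mu,\nu)=|\mu|\inf_{\pi}\int_{X\times X}d(x,y)\,d\pi(x,y),$$ where $\pi$ ranges over the Borel probability measures on $X\times X$ with $|\mu|\,\pi(A\times X)=\mu(A)$ and $|\nu|\,\pi(X\times B)=\nu(B)$ for all Borel $A,B\subseteq X$ (and $W_1(0,0)=0$). For $a,b>0$ and $\mu,\nu\in\mathcal M(X)$, the generalized Wasserstein distance is $$W_1^{a,b}(\mu,\nu)=\inf\bigl\{a|\mu-\tilde\mu|+a|\nu-\tilde\nu|+b\,W_1(\tilde\mu,\tilde\nu)\;:\;\tilde\mu,\tilde\nu\in\mathcal M_1(X),\ |\tilde\mu|=|\tilde\nu|\bigr\}.$$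 **Theorem.** For every $a,b>0$ and all $\mu,\nu\in\mathcal M(X)$, $W_1^{a,b}(\mu,\nu)$ is finite and $$W_1^{a,b}(\mu,\nu)=\sup\Bigl\{\int_X f\,d(\mu-\nu)\;:\;f\in C_b(X),\ \|f\|_\infty\le a,\ \|f\|_{\mathrm{Lip}}\le b\Bigr\},$$ where $\|f\|_{\mathrm{Lip}}=\sup_{x\ne y}|f(x)-f(y)|/d(x,y)$. That is, $W_1^{a,b}$ coincides with the flat (bounded-Lipschitz) metric with parameters $a,b$. -/

import Mathlib

open MeasureTheory
open scoped ENNReal BoundedContinuousFunction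

namespace GenWasserstein

noncomputable section

/-- Total variation `|μ - ν|` (the total mass of the total variation measure of the signed
measure `μ - ν`) of the difference of two finite measures. -/
def tvDist {X : Type*} [MeasurableSpace X] (μ ν : FiniteMeasure X) : ℝ≥0∞ :=
  ((μ : Measure X).toSignedMeasure - (ν : Measure X).toSignedMeasure).totalVariation Set.univ

/-- `μ` has finite `p`-moment. For nonempty `X` it is equivalent to require this for one base
point; on the empty space the zero measure has finite moments. -/
def HasFiniteMoment {X : Type*} [MetricSpace X] [MeasurableSpace X] (p : ℝ)
    (μ : FiniteMeasure X) : Prop :=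
  ∀ x₀ : X, ∫⁻ x, edist x x₀ ^ p ∂(μ : Measure X) < ∞

/-- `π` is a transference plan between `μ` and `ν`: a probability measure on `X × X` with
`|μ| π(A × X) = μ(A)` and `|ν| π(X × B) = ν(B)` for all Borel `A`, `B`. -/
def IsTransferencePlan {X : Type*} [MeasurableSpace X] (μ ν : FiniteMeasure X)
    (π : ProbabilityMeasure (X × X)) : Prop :=
  (∀ A : Set X, MeasurableSet A →
    (μ : Measure X) Set.univ * (π : Measure (X × X)) (A ×ˢ Set.univ) = (μ : Measure X) A) ∧
  (∀ B : Set X, MeasurableSet B →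
    (ν : Measure X) Set.univ * (π : Measure (X × X)) (Set.univ ×ˢ B) = (ν : Measure X) B)

/-- The transport cost `J_p(π) = ∫ d(x,y)^p dπ(x,y)`. -/
def transportCost {X : Type*} [MetricSpace X] [MeasurableSpace X] (p : ℝ)
    (π : ProbabilityMeasure (X × X)) : ℝ≥0∞ :=
  ∫⁻ z, edist z.1 z.2 ^ p ∂(π : Measure (X × X))

/-- The Wasserstein distance `W_p(μ,ν) = (|μ| inf_π J_p(π))^{1/p}`, used for finite measures
of the same mass. -/
def wasserstein {X : Type*} [MetricSpace X] [MeasurableSpace X] (p : ℝ)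
    (μ ν : FiniteMeasure X) : ℝ≥0∞ :=
  ((μ : Measure X) Set.univ *
    ⨅ (π : ProbabilityMeasure (X × X)) (_ : IsTransferencePlan μ ν π), transportCost p π)
      ^ (1 / p)

/-- The generalized Wasserstein distance `W_p^{a,b}(μ,ν)`: the infimum of
`a|μ - μ'| + a|ν - ν'| + b W_p(μ',ν')` over all finite measures `μ'`, `ν'` with finite
`p`-moment and the same mass. -/
def genWasserstein {X : Type*} [MetricSpace X] [MeasurableSpace X] (a b p : ℝ)
    (μ ν : FiniteMeasure X) : ℝ≥0∞ :=
  ⨅ (μ' : FiniteMeasure X) (ν' : FiniteMeasure X) (_ : HasFiniteMoment p μ')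
    (_ : HasFiniteMoment p ν') (_ : (μ' : Measure X) Set.univ = (ν' : Measure X) Set.univ),
    (ENNReal.ofReal a * tvDist μ μ' + ENNReal.ofReal a * tvDist ν ν'
      + ENNReal.ofReal b * wasserstein p μ' ν')

/-- `‖f‖_Lip`, the supremum of `|f x - f y| / d(x,y)` over `x ≠ y`, in `[0, ∞]`. -/
def lipSeminorm {X : Type*} [MetricSpace X] (f : X → ℝ) : ℝ≥0∞ :=
  ⨆ (x : X) (y : X) (_ : x ≠ y), ENNReal.ofReal (|f x - f y| / dist x y)

/-- The bounded continuous functions `f` with `‖f‖_∞ ≤ a` and `‖f‖_Lip ≤ b`. -/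
def flatTestFunctions (X : Type*) [MetricSpace X] (a b : ℝ) : Set (X →ᵇ ℝ) :=
  {f | ‖f‖ ≤ a ∧ lipSeminorm f ≤ ENNReal.ofReal b}

end

end GenWasserstein

/-!
Every finite measure on a separable metric space is, up to a small remainder, a combination of
probability measures living on small balls (`eventually_exists_isDiscretization`). Doing this for
`μ` and `ν` with the same finite family of centres reduces the duality to a finite-dimensional
partial transport problem, whose value `discreteValue` is a nonnegative sublinear function of the
pair of mass vectors. The Hahn–Banach theorem gives a linear functional supporting it at the pair in
question, and the coordinates of this functional are dual potentials without duality gap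
(`exists_discrete_potentials`).

Both sides of the discrete duality lift to `X`. A discrete plan becomes a coupling of two measures
close to `μ` and `ν`, so the generalized Wasserstein distance is at most the discrete value plus a
small error (`genWasserstein_le_discreteCost`). A pair of potentials `f`, `g` becomes the
single function `min a (inf_j (g j + b * dist · (x j)))`, which lies between `f` and `g` at the
centres, up to a small error, and is a test function for the flat metric
(`exists_flatTestFunction`). Letting the radius of the balls tend to `0` gives one inequality.

The other inequality is a direct estimate: integrating a test function against `μ - μ'` costs at
most `a` times the total variation, by the Jordan decomposition
(`integral_sub_integral_le_tvDist`), and against `μ' - ν'` at most `b` times the Wasserstein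
distance, since the difference of the integrals is an integral over any transference plan
(`integral_sub_integral_le_wasserstein`).
-/

namespace GenWasserstein

open Filter Topology Set
open scoped NNReal

/-! ### Finite linear programming duality -/

/-- Hahn–Banach at a point: a nonnegative sublinear function has a linear minorant that touches it
at any prescribed point. -/
lemma exists_linear_le_sublinear_eq {E : Type*} [AddCommGroup E] [Module ℝ E] (N : E → ℝ)
    (N_hom : ∀ c : ℝ, 0 < c → ∀ x, N (c • x) = c * N x) (N_add : ∀ x y, N (x + y) ≤ N x + N y)
    (N_nonneg : ∀ x, 0 ≤ N x) (z : E) :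
    ∃ φ : E →ₗ[ℝ] ℝ, φ z = N z ∧ ∀ x, φ x ≤ N x := by
  have N_zero : N 0 = 0 := by
    have := N_hom 2 two_pos 0
    rw [smul_zero] at this
    linarith
  rcases eq_or_ne z 0 with rfl | hz
  · exact ⟨0, by simp [N_zero], fun x => by simpa using N_nonneg x⟩
  · obtain ⟨φ, hφ, hle⟩ := exists_extension_of_le_sublinear
      (LinearPMap.mkSpanSingleton z (N z) hz) N N_hom N_add (by
        rintro ⟨x, hx⟩
        obtain ⟨t, rfl⟩ := Submodule.mem_span_singleton.1 hx
        rw [show LinearPMap.mkSpanSingleton z (N z) hz ⟨t • z, hx⟩ = t • N z from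
          LinearPMap.mkSpanSingleton'_apply z (N z) _ t hx]
        rcases lt_trichotomy t 0 with ht | rfl | ht
        · exact (mul_nonpos_of_nonpos_of_nonneg ht.le (N_nonneg z)).trans (N_nonneg _)
        · simp [N_zero]
        · exact (N_hom t ht z).ge)
    have hmem : z ∈ Submodule.span ℝ {z} := Submodule.mem_span_singleton_self z
    exact ⟨φ, (hφ ⟨z, hmem⟩).trans (LinearPMap.mkSpanSingleton_apply ℝ ℝ hz (N z)), hle⟩

section Discrete

variable {ι : Type*} [Fintype ι]

/-- The cost of the discrete plan `γ` as a way of matching the mass vectors `u` and `v`: moving a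
unit of mass from `i` to `j` costs `c i j`, and every unit by which a marginal of `γ` differs from
`u` or `v` costs `a`. -/
def discreteCost (a : ℝ) (c : ι → ι → ℝ) (γ : ι → ι → ℝ≥0) (u v : ι → ℝ) : ℝ :=
  ∑ i, ∑ j, (γ i j : ℝ) * c i j + a * ∑ i, |u i - ∑ j, (γ i j : ℝ)|
    + a * ∑ j, |v j - ∑ i, (γ i j : ℝ)|

/-- The least cost of a discrete plan matching `z.1` and `z.2`. -/
noncomputable def discreteValue (a : ℝ) (c : ι → ι → ℝ) (z : (ι → ℝ) × (ι → ℝ)) : ℝ :=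
  ⨅ γ : ι → ι → ℝ≥0, discreteCost a c γ z.1 z.2

variable {a : ℝ} {c : ι → ι → ℝ}

lemma discreteCost_nonneg (ha : 0 ≤ a) (hc : ∀ i j, 0 ≤ c i j) (γ : ι → ι → ℝ≥0)
    (u v : ι → ℝ) : 0 ≤ discreteCost a c γ u v := by
  have := Finset.sum_nonneg fun i (_ : i ∈ Finset.univ) =>
    Finset.sum_nonneg fun j (_ : j ∈ Finset.univ) => mul_nonneg (γ i j).2 (hc i j)
  unfold discreteCost
  exact add_nonneg (add_nonneg this (by positivity)) (by positivity)

lemma discreteCost_smul (t : ℝ≥0) (γ : ι → ι → ℝ≥0) (u v : ι → ℝ) :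
    discreteCost a c (t • γ) ((t : ℝ) • u) ((t : ℝ) • v) = t * discreteCost a c γ u v := by
  have h (x y : ℝ) : |(t : ℝ) * x - t * y| = t * |x - y| := by
    rw [← mul_sub, abs_mul, NNReal.abs_eq]
  simp only [discreteCost, Pi.smul_apply, smul_eq_mul, NNReal.coe_mul, ← Finset.mul_sum, h,
    mul_assoc]
  ring

lemma discreteCost_add_le (ha : 0 ≤ a) (γ γ' : ι → ι → ℝ≥0) (u v u' v' : ι → ℝ) :
    discreteCost a c (γ + γ') (u + u') (v + v')
      ≤ discreteCost a c γ u v + discreteCost a c γ' u' v' := by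
  have h (x y x' y' : ℝ) : |x + x' - (y + y')| ≤ |x - y| + |x' - y'| := by
    rw [add_sub_add_comm]
    exact abs_add_le _ _
  have h1 : a * ∑ i, |u i + u' i - (∑ j, (γ i j : ℝ) + ∑ j, (γ' i j : ℝ))|
      ≤ a * ∑ i, (|u i - ∑ j, (γ i j : ℝ)| + |u' i - ∑ j, (γ' i j : ℝ)|) := by
    gcongr; exact h _ _ _ _
  have h2 : a * ∑ j, |v j + v' j - (∑ i, (γ i j : ℝ) + ∑ i, (γ' i j : ℝ))|
      ≤ a * ∑ j, (|v j - ∑ i, (γ i j : ℝ)| + |v' j - ∑ i, (γ' i j : ℝ)|) := by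
    gcongr; exact h _ _ _ _
  simp only [Finset.sum_add_distrib, mul_add] at h1 h2
  simp only [discreteCost, Pi.add_apply, NNReal.coe_add, Finset.sum_add_distrib, add_mul]
  linarith

lemma discreteValue_le (ha : 0 ≤ a) (hc : ∀ i j, 0 ≤ c i j) (γ : ι → ι → ℝ≥0)
    (z : (ι → ℝ) × (ι → ℝ)) : discreteValue a c z ≤ discreteCost a c γ z.1 z.2 :=
  ciInf_le ⟨0, by rintro _ ⟨γ, rfl⟩; exact discreteCost_nonneg ha hc γ z.1 z.2⟩ γ

lemma discreteValue_smul (ha : 0 ≤ a) (hc : ∀ i j, 0 ≤ c i j) (t : ℝ) (ht : 0 < t)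
    (z : (ι → ℝ) × (ι → ℝ)) : discreteValue a c (t • z) = t * discreteValue a c z := by
  have key (s : ℝ≥0) (z : (ι → ℝ) × (ι → ℝ)) :
      discreteValue a c ((s : ℝ) • z) ≤ s * discreteValue a c z := by
    rw [discreteValue.eq_1 a c z, Real.mul_iInf_of_nonneg s.coe_nonneg]
    exact le_ciInf fun γ =>
      (discreteValue_le ha hc (s • γ) _).trans_eq (discreteCost_smul s γ z.1 z.2)
  lift t to ℝ≥0 using ht.le
  refine le_antisymm (key t z) ?_
  have h := key t⁻¹ ((t : ℝ) • z)
  rw [NNReal.coe_inv, inv_smul_smul₀ ht.ne'] at h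
  calc (t : ℝ) * discreteValue a c z ≤ t * ((t : ℝ)⁻¹ * discreteValue a c ((t : ℝ) • z)) := by
        gcongr
    _ = discreteValue a c ((t : ℝ) • z) := mul_inv_cancel_left₀ ht.ne' _

lemma exists_discreteCost_lt (a : ℝ) (c : ι → ι → ℝ) (z : (ι → ℝ) × (ι → ℝ)) {ε : ℝ}
    (hε : 0 < ε) : ∃ γ, discreteCost a c γ z.1 z.2 < discreteValue a c z + ε :=
  exists_lt_of_ciInf_lt (lt_add_of_pos_right (discreteValue a c z) hε)

lemma discreteValue_add_le (ha : 0 ≤ a) (hc : ∀ i j, 0 ≤ c i j) (z w : (ι → ℝ) × (ι → ℝ)) :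
    discreteValue a c (z + w) ≤ discreteValue a c z + discreteValue a c w := by
  refine le_of_forall_pos_le_add fun ε hε => ?_
  obtain ⟨γ, hγ⟩ := exists_discreteCost_lt a c z (half_pos hε)
  obtain ⟨γ', hγ'⟩ := exists_discreteCost_lt a c w (half_pos hε)
  have h := discreteValue_le ha hc (γ + γ') (z + w)
  have h' := discreteCost_add_le (c := c) ha γ γ' z.1 z.2 w.1 w.2
  simp only [Prod.fst_add, Prod.snd_add] at h
  linarith

/-- Absence of a duality gap for the discrete partial transport problem. The dual potentials are
the coordinates of a linear functional that supports the sublinear function `discreteValue` at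
`(m, n)`; the constraints on them are read off from the values at the basis vectors. -/
lemma exists_discrete_potentials (ha : 0 ≤ a) (hc : ∀ i j, 0 ≤ c i j) (m n : ι → ℝ) :
    ∃ f g : ι → ℝ, (∀ i, f i ≤ a) ∧ (∀ j, -a ≤ g j) ∧ (∀ i j, f i - g j ≤ c i j) ∧
      discreteValue a c (m, n) = ∑ i, f i * m i - ∑ j, g j * n j := by
  classical
  obtain ⟨φ, hφ, hle⟩ := exists_linear_le_sublinear_eq (discreteValue a c)
    (discreteValue_smul ha hc) (discreteValue_add_le ha hc)
    (fun z => le_ciInf fun γ => discreteCost_nonneg ha hc γ z.1 z.2) (m, n)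
  have hsplit (u v : ι → ℝ) : φ (u, v) = φ (u, 0) + φ (0, v) := by
    rw [← map_add]; simp
  have hsingle (i : ι) : (fun j => if i = j then 1 else 0) = (Pi.single i 1 : ι → ℝ) := by
    ext j; simp [Pi.single_apply, eq_comm]
  have hfst (u : ι → ℝ) : φ (u, 0) = ∑ i, φ (Pi.single i 1, 0) * u i := by
    simpa [mul_comm, hsingle] using
      LinearMap.pi_apply_eq_sum_univ (φ ∘ₗ LinearMap.inl ℝ (ι → ℝ) (ι → ℝ)) u
  have hsnd (v : ι → ℝ) : φ (0, v) = ∑ j, φ (0, Pi.single j 1) * v j := by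
    simpa [mul_comm, hsingle] using
      LinearMap.pi_apply_eq_sum_univ (φ ∘ₗ LinearMap.inr ℝ (ι → ℝ) (ι → ℝ)) v
  have habs (i : ι) : ∑ k, |(Pi.single i 1 : ι → ℝ) k| = 1 := by
    simp [Pi.single_apply, apply_ite abs]
  refine ⟨fun i => φ (Pi.single i 1, 0), fun j => - φ (0, Pi.single j 1), fun i => ?_,
    fun j => ?_, fun i j => ?_, ?_⟩
  · -- the zero plan leaves one unit of mass unmatched
    refine (hle _).trans ((discreteValue_le ha hc 0 _).trans_eq ?_)
    simp [discreteCost, habs]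
  · refine neg_le_neg ((hle _).trans ((discreteValue_le ha hc 0 _).trans_eq ?_))
    simp [discreteCost, habs]
  · rw [sub_neg_eq_add, ← hsplit]
    -- one unit of mass moved from `i` to `j`
    refine (hle _).trans
      ((discreteValue_le ha hc (fun k l => if k = i ∧ l = j then 1 else 0) _).trans_eq ?_)
    simp [discreteCost, Pi.single_apply, ite_and, apply_ite NNReal.toReal]
  · rw [← hφ, hsplit, hfst, hsnd]
    simp

end Discrete

/-! ### Total variation distance -/

section TotalVariation

variable {X : Type*} [MeasurableSpace X]

/-- The positive and negative parts of `μ - ν`, which attain the total variation distance. -/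
lemma exists_add_eq_add_tvDist_eq (μ ν : FiniteMeasure X) :
    ∃ α β : Measure X, IsFiniteMeasure α ∧ IsFiniteMeasure β ∧
      (μ : Measure X) + α = (ν : Measure X) + β ∧ tvDist μ ν = α univ + β univ := by
  set s := (μ : Measure X).toSignedMeasure - (ν : Measure X).toSignedMeasure with hs
  refine ⟨s.toJordanDecomposition.negPart, s.toJordanDecomposition.posPart, inferInstance,
    inferInstance, ?_, ?_⟩
  · rw [← Measure.toSignedMeasure_eq_toSignedMeasure_iff, Measure.toSignedMeasure_add,
      Measure.toSignedMeasure_add]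
    have h := s.toSignedMeasure_toJordanDecomposition
    rw [JordanDecomposition.toSignedMeasure] at h
    exact (sub_eq_sub_iff_add_eq_add.1 (h.trans hs)).symm.trans (add_comm _ _)
  · rw [tvDist, SignedMeasure.totalVariation, Measure.add_apply, add_comm]

lemma tvDist_le_of_add_eq_add (μ ν : FiniteMeasure X) (α β : Measure X) [IsFiniteMeasure α]
    [IsFiniteMeasure β] (h : (μ : Measure X) + α = (ν : Measure X) + β) :
    tvDist μ ν ≤ α univ + β univ := by
  set s := (μ : Measure X).toSignedMeasure - (ν : Measure X).toSignedMeasure with hs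
  -- on the Hahn set `i` the positive part is `s = β - α ≤ β`; on its complement `-s ≤ α`
  obtain ⟨i, hi, hpos, hneg, hp, hn⟩ := s.toJordanDecomposition_spec
  have hval (t : Set X) (ht : MeasurableSet t) : s t = β.real t - α.real t := by
    have := congrArg (fun ρ : Measure X => ρ.real t) h
    rw [measureReal_add_apply, measureReal_add_apply] at this
    rw [hs, Measure.toSignedMeasure_sub_apply ht]
    linarith
  have h1 : s.toJordanDecomposition.posPart.real univ ≤ β.real univ := by
    rw [hp, SignedMeasure.toMeasureOfZeroLE_real_apply _ hpos hi MeasurableSet.univ, inter_univ,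
      hval i hi]
    have := measureReal_mono (μ := β) (subset_univ i)
    linarith [measureReal_nonneg (μ := α) (s := i)]
  have h2 : s.toJordanDecomposition.negPart.real univ ≤ α.real univ := by
    rw [hn, SignedMeasure.toMeasureOfLEZero_real_apply _ hneg hi.compl MeasurableSet.univ,
      inter_univ, hval _ hi.compl]
    have := measureReal_mono (μ := α) (subset_univ iᶜ)
    linarith [measureReal_nonneg (μ := β) (s := iᶜ)]
  rw [tvDist, SignedMeasure.totalVariation, Measure.add_apply, add_comm]
  exact add_le_add
    ((ENNReal.toReal_le_toReal (measure_ne_top _ _) (measure_ne_top _ _)).1 h2)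
    ((ENNReal.toReal_le_toReal (measure_ne_top _ _) (measure_ne_top _ _)).1 h1)

lemma tvDist_zero_right_le (μ : FiniteMeasure X) : tvDist μ 0 ≤ (μ : Measure X) univ := by
  simpa using tvDist_le_of_add_eq_add μ 0 0 (μ : Measure X) (by simp)

lemma tvDist_comm (μ ν : FiniteMeasure X) : tvDist μ ν = tvDist ν μ := by
  rw [tvDist, tvDist, ← SignedMeasure.totalVariation_neg, neg_sub]

variable [TopologicalSpace X] [BorelSpace X]

lemma integral_sub_integral_le_tvDist (f : X →ᵇ ℝ) {a : ℝ} (hf : ‖f‖ ≤ a)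
    (μ ν : FiniteMeasure X) :
    ENNReal.ofReal (∫ x, f x ∂(μ : Measure X) - ∫ x, f x ∂(ν : Measure X))
      ≤ ENNReal.ofReal a * tvDist μ ν := by
  obtain ⟨α, β, hα, hβ, h, htv⟩ := exists_add_eq_add_tvDist_eq μ ν
  have hint : ∫ x, f x ∂(μ : Measure X) + ∫ x, f x ∂α
      = ∫ x, f x ∂(ν : Measure X) + ∫ x, f x ∂β := by
    rw [← integral_add_measure (f.integrable _) (f.integrable _), h,
      integral_add_measure (f.integrable _) (f.integrable _)]
  have hbound (ρ : Measure X) [IsFiniteMeasure ρ] : |∫ x, f x ∂ρ| ≤ a * ρ.real univ := by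
    simpa [mul_comm] using norm_integral_le_of_norm_le_const (μ := ρ) (f := f)
      (Eventually.of_forall fun x => (f.norm_coe_le_norm x).trans hf)
  rw [htv, ← ofReal_measureReal, ← ofReal_measureReal, ← ENNReal.ofReal_add (by positivity)
    (by positivity), ← ENNReal.ofReal_mul ((norm_nonneg f).trans hf)]
  apply ENNReal.ofReal_le_ofReal
  have h1 := abs_le.1 (hbound α)
  have h2 := abs_le.1 (hbound β)
  linarith

end TotalVariation

/-! ### Wasserstein distance and couplings -/

lemma lipSeminorm_le_iff {X : Type*} [MetricSpace X] {f : X → ℝ} {b : ℝ} (hb : 0 ≤ b) :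
    lipSeminorm f ≤ ENNReal.ofReal b ↔ ∀ x y, |f x - f y| ≤ b * dist x y := by
  simp only [lipSeminorm, iSup_le_iff, ENNReal.ofReal_le_ofReal_iff hb]
  refine forall₂_congr fun x y => ⟨fun h => ?_, fun h hxy => ?_⟩
  · rcases eq_or_ne x y with rfl | hxy
    · simp
    · exact (div_le_iff₀ (dist_pos.2 hxy)).1 (h hxy)
  · exact (div_le_iff₀ (dist_pos.2 hxy)).2 h

section Wasserstein

variable {X : Type*} [MetricSpace X] [MeasurableSpace X]

/-- Unnormalized couplings bound the Wasserstein distance from above. -/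
lemma wasserstein_le_lintegral (μ ν : FiniteMeasure X) (Γ : Measure (X × X)) [IsFiniteMeasure Γ]
    (hfst : Γ.map Prod.fst = μ) (hsnd : Γ.map Prod.snd = ν) :
    wasserstein 1 μ ν ≤ ∫⁻ z, edist z.1 z.2 ∂Γ := by
  have hμ (A : Set X) (hA : MeasurableSet A) : Γ (A ×ˢ univ) = (μ : Measure X) A := by
    rw [← hfst, Measure.map_apply measurable_fst hA, prod_univ]
  have hν (B : Set X) (hB : MeasurableSet B) : Γ (univ ×ˢ B) = (ν : Measure X) B := by
    rw [← hsnd, Measure.map_apply measurable_snd hB, univ_prod]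
  have hμ_univ : (μ : Measure X) univ = Γ univ := by rw [← hμ _ .univ, univ_prod_univ]
  have hν_univ : (ν : Measure X) univ = Γ univ := by rw [← hν _ .univ, univ_prod_univ]
  rw [wasserstein, div_one, ENNReal.rpow_one, hμ_univ]
  rcases eq_or_ne (Γ univ) 0 with h0 | h0
  -- here the infimum over plans may be `∞`, but `0 * ∞ = 0`
  · simp [h0]
  have htop : Γ univ ≠ ∞ := measure_ne_top _ _
  have : IsProbabilityMeasure ((Γ univ)⁻¹ • Γ) := ⟨by
    rw [Measure.smul_apply, smul_eq_mul, ENNReal.inv_mul_cancel h0 htop]⟩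
  have hplan : IsTransferencePlan μ ν ⟨(Γ univ)⁻¹ • Γ, this⟩ := by
    refine ⟨fun A hA => ?_, fun B hB => ?_⟩
    · rw [hμ_univ, ProbabilityMeasure.coe_mk, Measure.smul_apply, smul_eq_mul, ← mul_assoc,
        ENNReal.mul_inv_cancel h0 htop, one_mul, hμ A hA]
    · rw [hν_univ, ProbabilityMeasure.coe_mk, Measure.smul_apply, smul_eq_mul, ← mul_assoc,
        ENNReal.mul_inv_cancel h0 htop, one_mul, hν B hB]
  refine (mul_le_mul_right (iInf₂_le _ hplan) _).trans_eq ?_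
  simp only [transportCost, ProbabilityMeasure.coe_mk, lintegral_smul_measure, smul_eq_mul,
    ENNReal.rpow_one]
  rw [← mul_assoc, ENNReal.mul_inv_cancel h0 htop, one_mul]

variable [BorelSpace X]

lemma integral_sub_integral_le_wasserstein [SecondCountableTopology X] (f : X →ᵇ ℝ) {b : ℝ}
    (hb : 0 < b) (hf : ∀ x y, |f x - f y| ≤ b * dist x y) (μ ν : FiniteMeasure X)
    (hmass : (μ : Measure X) univ = (ν : Measure X) univ) :
    ENNReal.ofReal (∫ x, f x ∂(μ : Measure X) - ∫ x, f x ∂(ν : Measure X))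
      ≤ ENNReal.ofReal b * wasserstein 1 μ ν := by
  set M := (μ : Measure X) univ with hM
  have hMtop : M ≠ ∞ := measure_ne_top _ _
  rcases eq_or_ne M 0 with h0 | h0
  · rw [Measure.measure_univ_eq_zero.1 h0, Measure.measure_univ_eq_zero.1 (hmass.symm.trans h0)]
    simp
  have hK0 : ENNReal.ofReal b * M ≠ 0 := mul_ne_zero (by simpa using hb) h0
  have hKtop : ENNReal.ofReal b * M ≠ ∞ := ENNReal.mul_ne_top ENNReal.ofReal_ne_top hMtop
  rw [wasserstein, div_one, ENNReal.rpow_one, ← mul_assoc, ← hM,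
    ← ENNReal.div_le_iff' hK0 hKtop]
  refine le_iInf₂ fun π hπ => ?_
  rw [ENNReal.div_le_iff' hK0 hKtop]
  have hμ : (μ : Measure X) = M • (π : Measure (X × X)).map Prod.fst := by
    ext A hA
    rw [Measure.smul_apply, smul_eq_mul, Measure.map_apply measurable_fst hA, ← prod_univ,
      hπ.1 A hA]
  have hν : (ν : Measure X) = M • (π : Measure (X × X)).map Prod.snd := by
    ext A hA
    rw [Measure.smul_apply, smul_eq_mul, Measure.map_apply measurable_snd hA, ← univ_prod, hmass,
      hπ.2 A hA]
  have hf1 : Integrable (fun z : X × X => f z.1) (π : Measure (X × X)) :=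
    (f.compContinuous ⟨Prod.fst, continuous_fst⟩).integrable _
  have hf2 : Integrable (fun z : X × X => f z.2) (π : Measure (X × X)) :=
    (f.compContinuous ⟨Prod.snd, continuous_snd⟩).integrable _
  have hdiff : ∫ x, f x ∂(μ : Measure X) - ∫ x, f x ∂(ν : Measure X)
      = M.toReal * ∫ z, (f z.1 - f z.2) ∂(π : Measure (X × X)) := by
    rw [hμ, hν, integral_smul_measure, integral_smul_measure, integral_map, integral_map,
      integral_sub hf1 hf2, smul_eq_mul, smul_eq_mul, mul_sub]
    exacts [measurable_snd.aemeasurable, f.continuous.aestronglyMeasurable,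
      measurable_fst.aemeasurable, f.continuous.aestronglyMeasurable]
  rw [hdiff, ENNReal.ofReal_mul ENNReal.toReal_nonneg, ENNReal.ofReal_toReal hMtop,
    mul_comm (ENNReal.ofReal b), mul_assoc]
  gcongr
  calc ENNReal.ofReal (∫ z, (f z.1 - f z.2) ∂(π : Measure (X × X)))
      ≤ ‖∫ z, (f z.1 - f z.2) ∂(π : Measure (X × X))‖ₑ := Real.ofReal_le_enorm _
    _ ≤ ∫⁻ z, ‖f z.1 - f z.2‖ₑ ∂(π : Measure (X × X)) := enorm_integral_le_lintegral_enorm _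
    _ ≤ ∫⁻ z, ENNReal.ofReal b * edist z.1 z.2 ∂(π : Measure (X × X)) := by
        refine lintegral_mono fun z => ?_
        rw [Real.enorm_eq_ofReal_abs, edist_dist, ← ENNReal.ofReal_mul hb.le]
        exact ENNReal.ofReal_le_ofReal (hf _ _)
    _ = ENNReal.ofReal b * transportCost 1 π := by
        rw [lintegral_const_mul' _ _ ENNReal.ofReal_ne_top, transportCost]
        simp

end Wasserstein

/-! ### Approximation by localized measures -/

section Discretization

variable {X : Type*} [MetricSpace X] [MeasurableSpace X]

/-- The measure `μ` is, up to a remainder of mass at most `ε`, a combination with weights `m i` of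
probability measures `p i` that live within distance `ε` of the points `x i`. -/
structure IsDiscretization {ι : Type*} [Fintype ι] (x : ι → X) (ε : ℝ) (μ ρ : Measure X)
    (m : ι → ℝ≥0) (p : ι → Measure X) : Prop where
  remainder_le : ρ univ ≤ ENNReal.ofReal ε
  isProbabilityMeasure (i : ι) : IsProbabilityMeasure (p i)
  ae_dist_le (i : ι) : ∀ᵐ y ∂p i, dist y (x i) ≤ ε
  eq_add_sum : μ = ρ + ∑ i, m i • p i

variable [BorelSpace X]

/-- If `A` is a null set, the Dirac mass at `x` serves as the normalization of `μ.restrict A`. -/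
lemma exists_restrict_eq_smul (μ : Measure X) [IsFiniteMeasure μ] {A : Set X} {x : X} {ε : ℝ}
    (hε : 0 ≤ ε) (hA : MeasurableSet A) (hsub : A ⊆ Metric.closedBall x ε) :
    ∃ (m : ℝ≥0) (p : Measure X), IsProbabilityMeasure p ∧ (∀ᵐ y ∂p, dist y x ≤ ε) ∧
      μ.restrict A = m • p := by
  rcases eq_or_ne (μ A) 0 with h0 | h0
  · refine ⟨0, Measure.dirac x, inferInstance, ?_, by simp [Measure.restrict_eq_zero.2 h0]⟩
    rw [ae_dirac_iff (measurableSet_le (by fun_prop) (by fun_prop))]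
    simpa using hε
  · refine ⟨(μ A).toNNReal, ProbabilityTheory.cond μ A,
      ProbabilityTheory.cond_isProbabilityMeasure h0, ?_, ?_⟩
    · refine Measure.ae_smul_measure ?_ _
      filter_upwards [ae_restrict_mem hA] with y hy using hsub hy
    · rw [ProbabilityTheory.cond, ENNReal.smul_def, ENNReal.coe_toNNReal (measure_ne_top _ _),
        smul_smul, ENNReal.mul_inv_cancel h0 (measure_ne_top _ _), one_smul]

lemma eventually_exists_isDiscretization {x : ℕ → X} (hx : DenseRange x) (μ : Measure X)
    [IsFiniteMeasure μ] {ε : ℝ} (hε : 0 < ε) :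
    ∀ᶠ N in atTop, ∃ (ρ : Measure X) (m : Fin N → ℝ≥0) (p : Fin N → Measure X),
      IsDiscretization (fun i : Fin N => x i) ε μ ρ m p := by
  set A : ℕ → Set X := disjointed fun k => Metric.closedBall (x k) ε with hAdef
  have hA (k : ℕ) : MeasurableSet (A k) :=
    MeasurableSet.disjointed (fun _ => Metric.isClosed_closedBall.measurableSet) k
  have hdisj : Pairwise (Function.onFun Disjoint A) := disjoint_disjointed _
  have hcover : ⋃ k, A k = univ := by
    rw [hAdef, iUnion_disjointed, eq_univ_iff_forall]
    intro y
    obtain ⟨k, hk⟩ := hx.exists_dist_lt y hε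
    exact mem_iUnion.2 ⟨k, hk.le⟩
  -- by continuity from above, since the pieces exhaust `X` and `μ` is finite
  have hlim : Tendsto (fun N => μ (⋃ i : Fin N, A i)ᶜ) atTop (𝓝 0) := by
    have hempty : ⋂ N, (⋃ i : Fin N, A i)ᶜ = ∅ := by
      rw [← compl_iUnion, compl_empty_iff, eq_univ_iff_forall]
      intro y
      obtain ⟨k, hk⟩ := mem_iUnion.1 (hcover ▸ mem_univ y)
      exact mem_iUnion.2 ⟨k + 1, mem_iUnion.2 ⟨Fin.last k, hk⟩⟩
    rw [← measure_empty (μ := μ), ← hempty]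
    refine tendsto_measure_iInter_atTop
      (fun N => (MeasurableSet.iUnion fun _ => hA _).compl.nullMeasurableSet) ?_
      ⟨0, measure_ne_top _ _⟩
    intro N N' hN
    refine compl_subset_compl.2 (iUnion_subset fun i => ?_)
    exact subset_iUnion (fun j : Fin N' => A j) (Fin.castLE hN i)
  filter_upwards [hlim.eventually_le_const (ENNReal.ofReal_pos.2 hε)] with N hN
  choose m p hp hdist hres using fun i : Fin N => exists_restrict_eq_smul μ hε.le (hA i)
    (disjointed_subset (fun k => Metric.closedBall (x k) ε) i)
  have hdisjN : Pairwise (Function.onFun Disjoint fun i : Fin N => A i) := fun i j hij =>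
    hdisj (Fin.val_injective.ne hij)
  refine ⟨μ.restrict (⋃ i : Fin N, A i)ᶜ, m, p, ?_, hp, hdist, ?_⟩
  · rwa [Measure.restrict_apply_univ]
  · rw [← Finset.sum_congr rfl fun i _ => hres i, ← Measure.sum_fintype,
      ← Measure.restrict_iUnion hdisjN fun i => hA i, add_comm,
      Measure.restrict_add_restrict_compl (MeasurableSet.iUnion fun _ => hA _)]

end Discretization

/-! ### Comparison with the discrete problem -/

section Comparison

variable {X : Type*} [MetricSpace X] {ι : Type*} [Fintype ι] {x : ι → X} {ε a b : ℝ}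

section Measures

variable [MeasurableSpace X]

lemma IsDiscretization.tvDist_le {μ : FiniteMeasure X} {ρ : Measure X} {m : ι → ℝ≥0}
    {p : ι → Measure X} (h : IsDiscretization x ε μ ρ m p) (hε : 0 ≤ ε) (R : ι → ℝ≥0)
    (μ' : FiniteMeasure X) (hμ' : (μ' : Measure X) = ∑ i, R i • p i) :
    tvDist μ μ' ≤ ENNReal.ofReal (ε + ∑ i, |(m i : ℝ) - R i|) := by
  have := h.isProbabilityMeasure
  have hρ : IsFiniteMeasure ρ := ⟨h.remainder_le.trans_lt ENNReal.ofReal_lt_top⟩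
  -- subtraction in `ℝ≥0` is truncated, so each index contributes to one side only
  have hbalance : (μ : Measure X) + ∑ i, (R i - m i) • p i
      = (μ' : Measure X) + (ρ + ∑ i, (m i - R i) • p i) := by
    rw [h.eq_add_sum, hμ', add_assoc, add_left_comm _ ρ, ← Finset.sum_add_distrib,
      ← Finset.sum_add_distrib]
    congr 1
    refine Finset.sum_congr rfl fun i _ => ?_
    rw [← add_smul, ← add_smul, add_tsub_eq_max, add_tsub_eq_max, max_comm]
  refine (tvDist_le_of_add_eq_add μ μ' _ _ hbalance).trans ?_
  have hsum (t : ι → ℝ≥0) : (∑ i, t i • p i) univ = ENNReal.ofReal (∑ i, (t i : ℝ)) := by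
    rw [ENNReal.ofReal_sum_of_nonneg fun i _ => (t i).coe_nonneg]
    simp [Measure.finsetSum_apply]
  rw [Measure.add_apply, hsum, hsum]
  refine (add_le_add_right (add_le_add_left h.remainder_le _) _).trans_eq ?_
  rw [← ENNReal.ofReal_add hε (by positivity), ← ENNReal.ofReal_add (by positivity) (by positivity),
    add_left_comm, ← Finset.sum_add_distrib]
  congr 2
  refine Finset.sum_congr rfl fun i _ => ?_
  rcases le_total (m i) (R i) with hle | hle
  · rw [tsub_eq_zero_of_le hle, NNReal.coe_sub hle,
      abs_of_nonpos (sub_nonpos.2 (by exact_mod_cast hle))]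
    simp
  · rw [tsub_eq_zero_of_le hle, NNReal.coe_sub hle,
      abs_of_nonneg (sub_nonneg.2 (by exact_mod_cast hle))]
    simp

lemma hasFiniteMoment_of_eq_sum {p : ι → Measure X} (hprob : ∀ i, IsProbabilityMeasure (p i))
    (hp : ∀ i, ∀ᵐ y ∂p i, dist y (x i) ≤ ε) (R : ι → ℝ≥0) (μ' : FiniteMeasure X)
    (hμ' : (μ' : Measure X) = ∑ i, R i • p i) : HasFiniteMoment 1 μ' := by
  intro x₀
  simp only [ENNReal.rpow_one]
  rw [hμ', lintegral_finsetSum_measure, ENNReal.sum_lt_top]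
  intro i _
  have hle : ∫⁻ y, edist y x₀ ∂(p i) ≤ ENNReal.ofReal (ε + dist (x i) x₀) := by
    refine (lintegral_mono_ae (g := fun _ => ENNReal.ofReal (ε + dist (x i) x₀)) ?_).trans_eq
      (by simp)
    filter_upwards [hp i] with y hy
    rw [edist_dist]
    exact ENNReal.ofReal_le_ofReal ((dist_triangle y (x i) x₀).trans (by gcongr))
  rw [lintegral_smul_measure, ENNReal.smul_def, smul_eq_mul]
  exact ENNReal.mul_lt_top ENNReal.coe_lt_top (hle.trans_lt ENNReal.ofReal_lt_top)

/-- A discrete plan `γ` is realized by the coupling `∑ γ i j • (p i × q j)`, whose marginals serve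
as competitors in the definition of the generalized Wasserstein distance. -/
lemma genWasserstein_le_discreteCost {μ ν : FiniteMeasure X} {ρ ρ' : Measure X} {m n : ι → ℝ≥0}
    {p q : ι → Measure X} (hμ : IsDiscretization x ε μ ρ m p)
    (hν : IsDiscretization x ε ν ρ' n q) (hε : 0 ≤ ε) (ha : 0 ≤ a) (hb : 0 ≤ b)
    (γ : ι → ι → ℝ≥0) :
    genWasserstein a b 1 μ ν ≤ ENNReal.ofReal (2 * a * ε +
      discreteCost a (fun i j => b * (dist (x i) (x j) + 2 * ε)) γ (fun i => m i)
        (fun j => n j)) := by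
  have := hμ.isProbabilityMeasure
  have := hν.isProbabilityMeasure
  set Γ : Measure (X × X) := ∑ i, ∑ j, γ i j • (p i).prod (q j) with hΓ
  have hfst : Γ.map Prod.fst = ∑ i, (∑ j, γ i j) • p i := by
    ext A hA
    rw [Measure.map_apply measurable_fst hA, ← prod_univ, hΓ]
    simp only [Measure.finsetSum_apply, Measure.smul_apply, Measure.prod_prod, measure_univ,
      mul_one, Finset.sum_smul]
  have hsnd : Γ.map Prod.snd = ∑ j, (∑ i, γ i j) • q j := by
    ext A hA
    rw [Measure.map_apply measurable_snd hA, ← univ_prod, hΓ, Finset.sum_comm]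
    simp only [Measure.finsetSum_apply, Measure.smul_apply, Measure.prod_prod, measure_univ,
      one_mul, Finset.sum_smul]
  set μ' : FiniteMeasure X := ⟨∑ i, (∑ j, γ i j) • p i, inferInstance⟩ with hμ'
  set ν' : FiniteMeasure X := ⟨∑ j, (∑ i, γ i j) • q j, inferInstance⟩ with hν'
  have hmass : (μ' : Measure X) univ = (ν' : Measure X) univ := by
    have h1 := Measure.map_apply (μ := Γ) measurable_fst MeasurableSet.univ
    have h2 := Measure.map_apply (μ := Γ) measurable_snd MeasurableSet.univ
    rw [hfst] at h1
    rw [hsnd] at h2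
    exact h1.trans h2.symm
  have hcost (i j : ι) : ∫⁻ z, edist z.1 z.2 ∂((p i).prod (q j))
      ≤ ENNReal.ofReal (dist (x i) (x j) + 2 * ε) := by
    refine (lintegral_mono_ae
      (g := fun _ => ENNReal.ofReal (dist (x i) (x j) + 2 * ε)) ?_).trans_eq (by simp)
    have h1 : ∀ᵐ z ∂((p i).prod (q j)), dist z.1 (x i) ≤ ε :=
      Measure.quasiMeasurePreserving_fst.ae (hμ.ae_dist_le i)
    have h2 : ∀ᵐ z ∂((p i).prod (q j)), dist z.2 (x j) ≤ ε :=
      Measure.quasiMeasurePreserving_snd.ae (hν.ae_dist_le j)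
    filter_upwards [h1, h2] with z hz1 hz2
    rw [edist_dist]
    refine ENNReal.ofReal_le_ofReal ?_
    have := dist_triangle4 z.1 (x i) (x j) z.2
    rw [dist_comm (x j) z.2] at this
    linarith
  have hW : wasserstein 1 μ' ν'
      ≤ ENNReal.ofReal (∑ i, ∑ j, (γ i j : ℝ) * (dist (x i) (x j) + 2 * ε)) := by
    refine (wasserstein_le_lintegral μ' ν' Γ hfst hsnd).trans ?_
    rw [hΓ, lintegral_finsetSum_measure, ENNReal.ofReal_sum_of_nonneg fun i _ => by positivity]
    gcongr with i _
    rw [lintegral_finsetSum_measure, ENNReal.ofReal_sum_of_nonneg fun j _ => by positivity]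
    gcongr with j _
    rw [lintegral_smul_measure, ENNReal.smul_def, smul_eq_mul,
      ENNReal.ofReal_mul (γ i j).coe_nonneg, ENNReal.ofReal_coe_nnreal]
    gcongr
    exact hcost i j
  have htvμ := hμ.tvDist_le hε _ μ' rfl
  have htvν := hν.tvDist_le hε _ ν' rfl
  refine (iInf₂_le_of_le μ' ν' <| iInf₂_le_of_le
    (hasFiniteMoment_of_eq_sum hμ.isProbabilityMeasure hμ.ae_dist_le _ μ' rfl)
    (hasFiniteMoment_of_eq_sum hν.isProbabilityMeasure hν.ae_dist_le _ ν' rfl) <|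
    iInf_le_of_le hmass le_rfl).trans ?_
  refine (add_le_add (add_le_add (mul_le_mul_right htvμ _) (mul_le_mul_right htvν _))
    (mul_le_mul_right hW _)).trans_eq ?_
  rw [← ENNReal.ofReal_mul ha, ← ENNReal.ofReal_mul ha, ← ENNReal.ofReal_mul hb,
    ← ENNReal.ofReal_add (by positivity) (by positivity),
    ← ENNReal.ofReal_add (by positivity) (by positivity)]
  congr 1
  have hcb : ∑ i, ∑ j, (γ i j : ℝ) * (b * (dist (x i) (x j) + 2 * ε))
      = b * ∑ i, ∑ j, (γ i j : ℝ) * (dist (x i) (x j) + 2 * ε) := by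
    simp only [Finset.mul_sum, mul_left_comm]
  simp only [discreteCost, hcb, NNReal.coe_sum]
  ring

lemma IsDiscretization.sum_le_real_univ {μ : Measure X} [IsFiniteMeasure μ] {ρ : Measure X}
    {m : ι → ℝ≥0} {p : ι → Measure X} (h : IsDiscretization x ε μ ρ m p) :
    ∑ i, (m i : ℝ) ≤ μ.real univ := by
  have := h.isProbabilityMeasure
  have hle : ((∑ i, m i : ℝ≥0) : ℝ≥0∞) ≤ μ univ := by
    rw [h.eq_add_sum]
    simp
  rw [← NNReal.coe_sum]
  exact ENNReal.toReal_mono (measure_ne_top _ _) hle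

lemma IsDiscretization.abs_integral_sub_sum_le [BorelSpace X] {μ : Measure X} [IsFiniteMeasure μ]
    {ρ : Measure X} {m : ι → ℝ≥0} {p : ι → Measure X} (h : IsDiscretization x ε μ ρ m p)
    (hε : 0 ≤ ε) (hb : 0 ≤ b) (f : X →ᵇ ℝ) (hfa : ‖f‖ ≤ a)
    (hfb : ∀ x y, |f x - f y| ≤ b * dist x y) :
    |∫ y, f y ∂μ - ∑ i, f (x i) * m i| ≤ a * ε + b * ε * μ.real univ := by
  have := h.isProbabilityMeasure
  have hρ : IsFiniteMeasure ρ := ⟨h.remainder_le.trans_lt ENNReal.ofReal_lt_top⟩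
  have hsplit : ∫ y, f y ∂μ = ∫ y, f y ∂ρ + ∑ i, (m i : ℝ) * ∫ y, f y ∂(p i) := by
    conv_lhs => rw [h.eq_add_sum]
    rw [integral_add_measure (f.integrable _) (f.integrable _),
      integral_finsetSum_measure fun i _ => f.integrable _]
    simp only [integral_smul_nnreal_measure, NNReal.smul_def, smul_eq_mul]
  have hremainder : |∫ y, f y ∂ρ| ≤ a * ε := by
    refine (norm_integral_le_of_norm_le_const (μ := ρ) (f := f)
      (Eventually.of_forall fun y => (f.norm_coe_le_norm y).trans hfa)).trans ?_
    have : ρ.real univ ≤ ε := ENNReal.toReal_le_of_le_ofReal hε h.remainder_le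
    have := (norm_nonneg f).trans hfa
    gcongr
  have hlocal (i : ι) : |∫ y, f y ∂(p i) - f (x i)| ≤ b * ε := by
    have hsub : ∫ y, f y ∂(p i) - f (x i) = ∫ y, (f y - f (x i)) ∂(p i) := by
      rw [integral_sub (f.integrable _) (integrable_const _)]
      simp
    rw [hsub]
    have hae : ∀ᵐ y ∂p i, ‖f y - f (x i)‖ ≤ b * ε := by
      filter_upwards [h.ae_dist_le i] with y hy
      exact (hfb _ _).trans (by gcongr)
    simpa using norm_integral_le_of_norm_le_const hae
  calc |∫ y, f y ∂μ - ∑ i, f (x i) * m i|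
      = |∫ y, f y ∂ρ + ∑ i, (m i : ℝ) * (∫ y, f y ∂(p i) - f (x i))| := by
        simp only [hsplit, add_sub_assoc, mul_sub, Finset.sum_sub_distrib, mul_comm (f _)]
    _ ≤ |∫ y, f y ∂ρ| + ∑ i, (m i : ℝ) * |∫ y, f y ∂(p i) - f (x i)| := by
        refine (abs_add_le _ _).trans (add_le_add_right ?_ _)
        refine (Finset.abs_sum_le_sum_abs _ _).trans_eq ?_
        simp only [abs_mul, NNReal.abs_eq]
    _ ≤ a * ε + ∑ i, (m i : ℝ) * (b * ε) := by
        gcongr with i _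
        exact hlocal i
    _ ≤ a * ε + b * ε * μ.real univ := by
        rw [← Finset.sum_mul, mul_comm (b * ε)]
        gcongr
        exact h.sum_le_real_univ

end Measures

/-- Discrete potentials are replaced by a single test function, the infimal convolution of `g` with
`b • dist`, truncated at height `a`. -/
lemma exists_flatTestFunction (ha : 0 ≤ a) (hb : 0 ≤ b) {δ : ℝ} (hδ : 0 ≤ δ) (f g : ι → ℝ)
    (hf : ∀ i, f i ≤ a) (hg : ∀ j, -a ≤ g j)
    (hfg : ∀ i j, f i - g j ≤ b * dist (x i) (x j) + δ) :
    ∃ h ∈ flatTestFunctions X a b, ∀ i, f i - δ ≤ h (x i) ∧ h (x i) ≤ g i := by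
  -- the index `none` carries the truncation
  set F : Option ι → X → ℝ := fun o y => o.elim a fun j => g j + b * dist y (x j) with hF
  have hFlip (o : Option ι) (y z : X) : F o y ≤ F o z + b * dist y z := by
    cases o with
    | none => simpa [hF] using by positivity
    | some j =>
      have := mul_le_mul_of_nonneg_left (dist_triangle y z (x j)) hb
      simp only [hF, Option.elim_some]
      linarith
  have hFge (o : Option ι) (y : X) : -a ≤ F o y := by
    cases o with
    | none => simpa [hF] using ha
    | some j => exact (hg j).trans (le_add_of_nonneg_right (by positivity))
  have hbdd (y : X) : BddBelow (range fun o => F o y) := (finite_range _).bddBelow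
  set h : X → ℝ := fun y => ⨅ o, F o y with hh
  have hlip (y z : X) : h y ≤ h z + b * dist y z := by
    rw [← sub_le_iff_le_add]
    exact le_ciInf fun o =>
      sub_le_iff_le_add.2 ((ciInf_le (hbdd y) o).trans (hFlip o y z))
  have habs (y z : X) : |h y - h z| ≤ b * dist y z := by
    have h1 := hlip y z
    have h2 := hlip z y
    rw [dist_comm z y] at h2
    rw [abs_le]
    constructor <;> linarith
  have hbound (y : X) : ‖h y‖ ≤ a :=
    abs_le.2 ⟨le_ciInf fun o => hFge o y, ciInf_le (hbdd y) none⟩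
  have hcont : Continuous h :=
    (LipschitzWith.of_dist_le_mul (K := ⟨b, hb⟩) fun y z => habs y z).continuous
  refine ⟨BoundedContinuousFunction.ofNormedAddCommGroup h hcont a hbound,
    ⟨BoundedContinuousFunction.norm_ofNormedAddCommGroup_le _ ha hbound,
      (lipSeminorm_le_iff hb).2 habs⟩, fun i => ⟨le_ciInf fun o => ?_, ?_⟩⟩
  · cases o with
    | none => exact (sub_le_self _ hδ).trans (hf i)
    | some j =>
      have := hfg i j
      simp only [Option.elim_some, hF]
      linarith
  · exact (ciInf_le (hbdd (x i)) (some i)).trans_eq (by simp [hF])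

end Comparison

/-! ### The duality formula -/

section Duality

variable {X : Type*} [MetricSpace X] [MeasurableSpace X] {a b : ℝ}

/-- The cost of removing all mass. -/
lemma genWasserstein_le_mass (a b : ℝ) (μ ν : FiniteMeasure X) :
    genWasserstein a b 1 μ ν
      ≤ ENNReal.ofReal a * (μ : Measure X) univ + ENNReal.ofReal a * (ν : Measure X) univ := by
  have hmom : HasFiniteMoment 1 (0 : FiniteMeasure X) := fun x₀ => by simp
  refine (iInf₂_le_of_le 0 0 <| iInf₂_le_of_le hmom hmom <| iInf_le_of_le rfl le_rfl).trans ?_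
  have hW : wasserstein 1 (0 : FiniteMeasure X) 0 = 0 := by simp [wasserstein]
  rw [hW, mul_zero, add_zero]
  gcongr <;> exact tvDist_zero_right_le _

lemma genWasserstein_ne_top (a b : ℝ) (μ ν : FiniteMeasure X) :
    genWasserstein a b 1 μ ν ≠ ∞ := by
  have h (ρ : FiniteMeasure X) : ENNReal.ofReal a * (ρ : Measure X) univ ≠ ∞ :=
    ENNReal.mul_ne_top ENNReal.ofReal_ne_top (measure_ne_top _ _)
  exact ne_top_of_le_ne_top (ENNReal.add_ne_top.2 ⟨h μ, h ν⟩) (genWasserstein_le_mass a b μ ν)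

variable [BorelSpace X] [SecondCountableTopology X]

lemma integral_sub_integral_le_genWasserstein (hb : 0 < b) (f : X →ᵇ ℝ)
    (hf : f ∈ flatTestFunctions X a b) (μ ν : FiniteMeasure X) :
    ENNReal.ofReal (∫ x, f x ∂(μ : Measure X) - ∫ x, f x ∂(ν : Measure X))
      ≤ genWasserstein a b 1 μ ν := by
  refine le_iInf₂ fun μ' ν' => le_iInf₂ fun _ _ => le_iInf fun hmass => ?_
  have h1 := integral_sub_integral_le_tvDist f hf.1 μ μ'
  have h2 := integral_sub_integral_le_tvDist f hf.1 ν' ν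
  rw [tvDist_comm] at h2
  have h3 := integral_sub_integral_le_wasserstein f hb ((lipSeminorm_le_iff hb.le).1 hf.2) μ' ν'
    hmass
  refine le_trans ?_ (add_le_add (add_le_add h1 h2) h3)
  refine le_trans (ENNReal.ofReal_le_ofReal (le_of_eq ?_))
    (ENNReal.ofReal_add_le.trans (add_le_add_left ENNReal.ofReal_add_le _))
  ring

/-- The value of the discrete problem equals its dual value, which is nearly attained by a test
function for the flat metric; all errors are of order `ε`. -/
lemma exists_toReal_genWasserstein_le [Nonempty X] (ha : 0 ≤ a) (hb : 0 ≤ b)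
    (μ ν : FiniteMeasure X) {ε : ℝ} (hε : 0 < ε) :
    ∃ f ∈ flatTestFunctions X a b, (genWasserstein a b 1 μ ν).toReal
      ≤ ∫ x, f x ∂(μ : Measure X) - ∫ x, f x ∂(ν : Measure X)
        + ε * (4 * a + 1 + 3 * b * (μ : Measure X).real univ
          + b * (ν : Measure X).real univ) := by
  obtain ⟨N, ⟨ρ, m, p, hμ⟩, ⟨ρ', n, q, hν⟩⟩ :=
    ((eventually_exists_isDiscretization (TopologicalSpace.denseRange_denseSeq X) μ hε).and
      (eventually_exists_isDiscretization (TopologicalSpace.denseRange_denseSeq X) ν hε)).exists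
  set x : Fin N → X := fun i => TopologicalSpace.denseSeq X i with hx
  set c : Fin N → Fin N → ℝ := fun i j => b * (dist (x i) (x j) + 2 * ε) with hc
  have hc0 (i j : Fin N) : 0 ≤ c i j := by positivity
  obtain ⟨f, g, hf, hg, hfg, hval⟩ :=
    exists_discrete_potentials ha hc0 (fun i => (m i : ℝ)) (fun j => (n j : ℝ))
  obtain ⟨h, hh, hhfg⟩ := exists_flatTestFunction (x := x) (δ := 2 * b * ε) ha hb (by positivity)
    f g hf hg fun i j => (hfg i j).trans_eq (by simp only [hc]; ring)
  obtain ⟨γ, hγ⟩ := exists_discreteCost_lt a c (fun i => (m i : ℝ), fun j => (n j : ℝ)) hε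
  refine ⟨h, hh, ?_⟩
  have hlip := (lipSeminorm_le_iff hb).1 hh.2
  have hprimal : (genWasserstein a b 1 μ ν).toReal ≤ 2 * a * ε +
      discreteCost a c γ (fun i => (m i : ℝ)) (fun j => (n j : ℝ)) :=
    ENNReal.toReal_le_of_le_ofReal
      (add_nonneg (by positivity) (discreteCost_nonneg ha hc0 _ _ _))
      (genWasserstein_le_discreteCost hμ hν hε.le ha hb γ)
  have h1 := (abs_le.1 (hμ.abs_integral_sub_sum_le hε.le hb h hh.1 hlip)).1
  have h2 := (abs_le.1 (hν.abs_integral_sub_sum_le hε.le hb h hh.1 hlip)).2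
  have h3 : ∑ i, f i * (m i : ℝ) ≤ ∑ i, h (x i) * m i + 2 * b * ε * (μ : Measure X).real univ := by
    calc ∑ i, f i * (m i : ℝ) ≤ ∑ i, (h (x i) + 2 * b * ε) * (m i : ℝ) := by
          gcongr with i _
          linarith [(hhfg i).1]
      _ = ∑ i, h (x i) * m i + 2 * b * ε * ∑ i, (m i : ℝ) := by
          simp only [add_mul, Finset.sum_add_distrib, Finset.mul_sum]
      _ ≤ _ := by
          gcongr
          exact hμ.sum_le_real_univ
  have h4 : ∑ j, h (x j) * (n j : ℝ) ≤ ∑ j, g j * (n j : ℝ) := by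
    gcongr with j _
    exact (hhfg j).2
  linarith

end Duality

end GenWasserstein

theorem mainTheorem2 {X : Type*} [MetricSpace X] [CompleteSpace X] [SecondCountableTopology X]
    [MeasurableSpace X] [BorelSpace X] (a b : ℝ) (ha : 0 < a) (hb : 0 < b)
    (μ ν : FiniteMeasure X) :
    GenWasserstein.genWasserstein a b 1 μ ν ≠ ∞ ∧
    IsLUB ((fun f : X →ᵇ ℝ => ∫ x, f x ∂(μ : Measure X) - ∫ x, f x ∂(ν : Measure X)) ''
        GenWasserstein.flatTestFunctions X a b)
      (GenWasserstein.genWasserstein a b 1 μ ν).toReal := by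
  have htop := GenWasserstein.genWasserstein_ne_top a b μ ν
  refine ⟨htop, ?_, fun B hB => ?_⟩
  · rintro _ ⟨f, hf, rfl⟩
    exact (ENNReal.ofReal_le_iff_le_toReal htop).1
      (GenWasserstein.integral_sub_integral_le_genWasserstein hb f hf μ ν)
  · rcases isEmpty_or_nonempty X with hX | hX
    · have h0 : GenWasserstein.genWasserstein a b 1 μ ν = 0 := by
        simpa [Set.univ_eq_empty_iff.2 hX] using GenWasserstein.genWasserstein_le_mass a b μ ν
      refine hB ⟨0, ⟨by simpa using ha.le, ?_⟩, by simp [h0]⟩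
      exact (GenWasserstein.lipSeminorm_le_iff hb.le).2 fun x => isEmptyElim x
    · set C := 4 * a + 1 + 3 * b * (μ : Measure X).real Set.univ
        + b * (ν : Measure X).real Set.univ with hC
      have hC0 : 0 < C := by positivity
      refine le_of_forall_pos_le_add fun δ hδ => ?_
      obtain ⟨f, hf, hle⟩ := GenWasserstein.exists_toReal_genWasserstein_le ha.le hb.le μ ν
        (div_pos hδ hC0)
      rw [← hC, div_mul_cancel₀ _ hC0.ne'] at hle
      exact hle.trans (add_le_add_left (hB ⟨f, hf, rfl⟩) _)
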